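/- **Setting.** Let $\Pi_0=(\Sigma_0,\mathsf{Pred})$ be a signature, $\mathcal T_0$ a set of first-order $\Pi_0$-sentences, $\Sigma$ a set of new function symbols (*extension functions*), $\Pi=(\Sigma_0\cup\Sigma,\mathsf{Pred})$, and $\mathcal K$ a set of universally closed clauses over $\Pi$. Consider partial $\Pi$-structures $M$ with non-empty universe $|M|$, total $\Sigma_0$-functions, and possibly partial $\Sigma$-functions (constants are always defined). Terms are evaluated strictly. $M$ is a *weak partial model* of $\mathcal K$ if for every clause of $\mathcal K$ and every valuation, some literal of the clause is undefined or at least one literal is true. Let $$T(M)=\{f(a_1,\dots,a_n)\mid f\in\Sigma,\ a_i\in|M|,\ f_M(a_1,\dots,a_n)\text{ is defined}\},$$ a set of ground terms with the elements of $|M|$ as additional constants. $\mathsf{PMod}$ is the class of such $M$ whose $\Pi_0$-reduct is a (total) model of $\mathcal T_0$, which are weak partial models of $\mathcal K$, and for which $T(M)$ is finite. A *weak embedding* is an injective map $\varphi$ which preserves and reflects all predicates and satisfies: if $f_M(\bar a)$ is defined, then $f_N(\varphi(\bar a))$ is defined and equal to $\varphi(f_M(\bar a))$. An *amalgamation closure*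 $W$ assigns to finite sets $S,T$ of ground terms over $\Pi$ with additional constants (from an arbitrary set of constants) a finite set $W(S,T)$ of such terms, where (i) all ground terms occurring in $\mathcal K$ and all subterms of $S$ are in $W(S,T)$; (ii) $W$ is monotone in both arguments; (iii) $W(W(S,T),W(T,S))\subseteq W(S,T)$; (iv) $W(h(S),h(T))=h(W(S,T))$ for every map $h$ of additional constants such that $h(c_1)\ne h(c_2)$ for all additional constants $c_1$ occurring in $S$ but not in $T$ and $c_2$ occurring in $T$ but not in $S$; (v) all additional constants in $W(S,T)$ occur in $S$. Structures $M_A,M_B$ are called *$W$-closed* if all terms of $W(T(M_A),T(M_B))$ are defined in $M_A$ and all terms of $W(T(M_B),T(M_A))$ are defined in $M_B$. * $\mathcal T_0\cup\mathcal K$ has the *partial $W$-amalgamation property* if for all $M_A,M_B,M_C\in\mathsf{PMod}$ such that $|M_C|=|M_A|\cap|M_B|$, the inclusions of $M_C$ into $M_A$ and $M_B$ are weak embeddings, $M_A,M_B$ are $W$-closed, and $T(M_A)\cap T(M_B)\subseteq T(M_C)$, there are a total model $M_D$ of $\mathcal T_0\cup\mathcal K$ and weak embeddings $h_A:M_A\to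 M_D$, $h_B:M_B\to M_D$ which agree on $|M_C|$. * $\mathcal T_0\cup\mathcal K$ has the *partial $W$-amalgamation property for models with the same $\Pi_0$-reduct* if for all $W$-closed $M_A,M_B\in\mathsf{PMod}$ with the same $\Pi_0$-reduct such that $f_{M_A}(\bar m)=f_{M_B}(\bar m)$ whenever both are defined ($f\in\Sigma$), there are a total model $M_D$ of $\mathcal T_0\cup\mathcal K$ and weak embeddings $h_A:M_A\to M_D$, $h_B:M_B\to M_D$ with $h_A=h_B$ as functions. * $\mathcal T_0$ has *general ground interpolation* if for every signature $\Sigma'$ (of constants, function and predicate symbols) disjoint from $\Pi_0$ and all ground formulae $A,B$ over $\Pi_0\cup\Sigma'$ with $A\wedge B\models_{\mathcal T_0}\bot$ (the symbols of $\Sigma'$ being uninterpreted) there is a ground formula $I$ over $\Pi_0\cup\Sigma'$ whose symbols from $\Sigma'$ all occur both in $A$ and in $B$, such that $A\models_{\mathcal T_0}I$ and $B\wedge I\models_{\mathcal T_0}\bot$. **Proposition.** Let $W$ be an amalgamation closure for $\mathcal T_0\cup\mathcal K$. 1. If $\mathcal T_0\cup\mathcal K$ has the partial $W$-amalgamation property,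 then it has the partial $W$-amalgamation property for models with the same $\Pi_0$-reduct. 2. Suppose that every variable of a clause of $\mathcal K$ occurs in that clause as a direct argument of an extension function (for instance, $\mathcal K$ is flat or quasi-flat, and all variables occur below an extension function). If $\mathcal T_0$ has general ground interpolation and $\mathcal T_0\cup\mathcal K$ has the partial $W$-amalgamation property for models with the same $\Pi_0$-reduct, then $\mathcal T_0\cup\mathcal K$ has the partial $W$-amalgamation property. -/

import Mathlib

open FirstOrder FirstOrder.Language

universe u

namespace WAmalg

/-! ### Occurrences of symbols and general ground interpolation -/

section Symbols

variable {L : FirstOrder.Language.{u, u}}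

/-- The function symbols (constants included) occurring in a term. -/
def termFunctions {α : Type*} : L.Term α → Set (Σ n, L.Functions n)
  | .var _ => ∅
  | .func f ts => {⟨_, f⟩} ∪ ⋃ i, termFunctions (ts i)

/-- The function symbols (constants included) occurring in a formula. -/
def formulaFunctions {α : Type*} : {n : ℕ} → L.BoundedFormula α n → Set (Σ n, L.Functions n)
  | _, .falsum => ∅
  | _, .equal t s => termFunctions t ∪ termFunctions s
  | _, .rel _ ts => ⋃ i, termFunctions (ts i)
  | _, .imp φ ψ => formulaFunctions φ ∪ formulaFunctions ψ
  | _, .all φ => formulaFunctions φ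

/-- The predicate symbols occurring in a formula (equality is a logical symbol). -/
def formulaRelations {α : Type*} : {n : ℕ} → L.BoundedFormula α n → Set (Σ n, L.Relations n)
  | _, .falsum => ∅
  | _, .equal _ _ => ∅
  | _, .rel R _ => {⟨_, R⟩}
  | _, .imp φ ψ => formulaRelations φ ∪ formulaRelations ψ
  | _, .all φ => formulaRelations φ

end Symbols

/-- General ground interpolation. For every signature `L'` disjoint from that of `T` and all ground
formulae (quantifier-free sentences) `A`, `B` over the union of the signatures: if `A ∧ B` is
inconsistent with `T` (the symbols of `L'` being uninterpreted), then there is a ground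
formula `I`, whose `L'`-symbols all occur both in `A` and in `B`, such that `A` entails `I` and
`B ∧ I` is inconsistent, modulo `T`. -/
def GeneralGroundInterpolation {L : FirstOrder.Language.{u, u}} (T : L.Theory) : Prop :=
  ∀ (L' : FirstOrder.Language.{u, u}) (A B : (L.sum L').Sentence), A.IsQF → B.IsQF →
    ((LHom.sumInl : L →ᴸ L.sum L').onTheory T ⊨ᵇ (A ⊓ B).imp ⊥) →
    ∃ I : (L.sum L').Sentence, I.IsQF ∧
      (∀ (n : ℕ) (f : L'.Functions n),
        (⟨n, Sum.inr f⟩ : Σ n, (L.sum L').Functions n) ∈ formulaFunctions I →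
          (⟨n, Sum.inr f⟩ : Σ n, (L.sum L').Functions n) ∈ formulaFunctions A ∧
          (⟨n, Sum.inr f⟩ : Σ n, (L.sum L').Functions n) ∈ formulaFunctions B) ∧
      (∀ (n : ℕ) (R : L'.Relations n),
        (⟨n, Sum.inr R⟩ : Σ n, (L.sum L').Relations n) ∈ formulaRelations I →
          (⟨n, Sum.inr R⟩ : Σ n, (L.sum L').Relations n) ∈ formulaRelations A ∧
          (⟨n, Sum.inr R⟩ : Σ n, (L.sum L').Relations n) ∈ formulaRelations B) ∧
      ((LHom.sumInl : L →ᴸ L.sum L').onTheory T ⊨ᵇ A.imp I) ∧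
      ((LHom.sumInl : L →ᴸ L.sum L').onTheory T ⊨ᵇ (B ⊓ I).imp ⊥)

/-! ### Terms and clauses

`L₀` is the base signature and `L₁` (which has no predicate symbols) is the set of extension
functions. An element of `(L₀.sum L₁).Term X` is read as a term with variables in `X`, or as a
ground term in the signature expanded by a fresh constant for each element of `X`. -/

/-- The set of subterms of a term. -/
def subterms {L : FirstOrder.Language.{u, u}} {α : Type*} : L.Term α → Set (L.Term α)
  | .var x => {.var x}
  | .func f ts => {.func f ts} ∪ ⋃ i, subterms (ts i)

/-- The set of subterms `st(S)` of a set of terms. -/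
def st {L : FirstOrder.Language.{u, u}} {α : Type*} (S : Set (L.Term α)) : Set (L.Term α) :=
  ⋃ t ∈ S, subterms t

/-- The set of those elements of `α` (variables, or fresh constants) occurring in a set of terms. -/
def atomsOf {L : FirstOrder.Language.{u, u}} {α : Type*} (S : Set (L.Term α)) : Set α :=
  {x | Term.var x ∈ st S}

inductive Atom (L₀ L₁ : FirstOrder.Language.{u, u}) (α : Type*)
  | eq (t s : (L₀.sum L₁).Term α) : Atom L₀ L₁ α
  | rel {n : ℕ} (R : L₀.Relations n) (ts : Fin n → (L₀.sum L₁).Term α) : Atom L₀ L₁ α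

inductive Literal (L₀ L₁ : FirstOrder.Language.{u, u}) (α : Type*)
  | pos (a : Atom L₀ L₁ α) : Literal L₀ L₁ α
  | neg (a : Atom L₀ L₁ α) : Literal L₀ L₁ α

/-- A clause is a finite disjunction of literals, implicitly universally quantified over its
variables, which are taken from the countable set `ℕ`. -/
abbrev Clause (L₀ L₁ : FirstOrder.Language.{u, u}) : Type u := List (Literal L₀ L₁ ℕ)

variable {L₀ L₁ : FirstOrder.Language.{u, u}}

/-- The terms that are the sides of an equation or the arguments of a predicate. -/
def Atom.terms {α : Type*} : Atom L₀ L₁ α → Set ((L₀.sum L₁).Term α)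
  | .eq t s => {t, s}
  | .rel _ ts => Set.range ts

def Literal.atom {α : Type*} : Literal L₀ L₁ α → Atom L₀ L₁ α
  | .pos a => a
  | .neg a => a

/-- All terms occurring in a clause. -/
def Clause.st (C : Clause L₀ L₁) : Set ((L₀.sum L₁).Term ℕ) :=
  ⋃ l ∈ C, WAmalg.st l.atom.terms

/-- Every variable of a clause of `K` occurs in that clause as a direct argument of an extension
function. -/
def VariablesGuarded (K : Set (Clause L₀ L₁)) : Prop :=
  ∀ C ∈ K, ∀ x : ℕ, Term.var x ∈ Clause.st C →
    ∃ (n : ℕ) (f : L₁.Functions n) (ts : Fin n → (L₀.sum L₁).Term ℕ) (i : Fin n),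
      Term.func (Sum.inr f) ts ∈ Clause.st C ∧ ts i = Term.var x

/-- The ground (variable-free) terms occurring in `K`. -/
def groundTerms (K : Set (Clause L₀ L₁)) : Set ((L₀.sum L₁).Term Empty) :=
  {t | ∃ C ∈ K, t.relabel Empty.elim ∈ Clause.st C}

/-! ### Amalgamation closures -/

/-- A binary operator on sets of ground terms, given for every set `X` of fresh constants. Only its
values on finite sets matter. -/
abbrev TermOperator (L₀ L₁ : FirstOrder.Language.{u, u}) : Type (u + 1) :=
  ∀ X : Type u, Set ((L₀.sum L₁).Term X) → Set ((L₀.sum L₁).Term X) → Set ((L₀.sum L₁).Term X)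

/-- `W` is an amalgamation closure for the extension by `K`. -/
structure IsAmalgamationClosure (K : Set (Clause L₀ L₁)) (W : TermOperator L₀ L₁) : Prop where
  finite : ∀ (X : Type u) (S T : Set ((L₀.sum L₁).Term X)), S.Finite → T.Finite → (W X S T).Finite
  groundTerms_mem : ∀ (X : Type u) (S T : Set ((L₀.sum L₁).Term X)), S.Finite → T.Finite →
    ∀ t ∈ groundTerms K, t.relabel Empty.elim ∈ W X S T
  st_subset : ∀ (X : Type u) (S T : Set ((L₀.sum L₁).Term X)), S.Finite → T.Finite →
    st S ⊆ W X S T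
  mono : ∀ (X : Type u) (S T S' T' : Set ((L₀.sum L₁).Term X)), S'.Finite → T'.Finite →
    S ⊆ S' → T ⊆ T' → W X S T ⊆ W X S' T'
  closure : ∀ (X : Type u) (S T : Set ((L₀.sum L₁).Term X)), S.Finite → T.Finite →
    W X (W X S T) (W X T S) ⊆ W X S T
  /-- Compatibility with maps of constants that separate the non-shared constants of `S` from the
  non-shared constants of `T`. -/
  compat : ∀ (X Y : Type u) (h : X → Y) (S T : Set ((L₀.sum L₁).Term X)), S.Finite → T.Finite →
    (∀ c₁ ∈ atomsOf S \ atomsOf T, ∀ c₂ ∈ atomsOf T \ atomsOf S, h c₁ ≠ h c₂) →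
    W Y (Term.relabel h '' S) (Term.relabel h '' T) = Term.relabel h '' W X S T
  pure : ∀ (X : Type u) (S T : Set ((L₀.sum L₁).Term X)), S.Finite → T.Finite →
    atomsOf (W X S T) ⊆ atomsOf S

/-! ### Partial structures -/

/-- A partial structure with universe `M` in which the base signature `L₀` is interpreted by an
ordinary (total) structure and the extension functions are partial; constants are defined. -/
structure PartialExpansion (L₀ L₁ : FirstOrder.Language.{u, u}) (M : Type u) extends L₀.Structure M where
  nonempty : Nonempty M
  extFun : ∀ {n : ℕ}, L₁.Functions n → (Fin n → M) → Part M
  const_dom : ∀ (c : L₁.Functions 0) (a : Fin 0 → M), (extFun c a).Dom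

/-- A tuple of partial values is defined iff all its components are. -/
def partTuple {M : Type u} {n : ℕ} (p : Fin n → Part M) : Part (Fin n → M) :=
  ⟨∀ i, (p i).Dom, fun h i => (p i).get (h i)⟩

namespace PartialExpansion

variable {M : Type u} (A : PartialExpansion L₀ L₁ M)

/-- The partial evaluation of terms. -/
def eval {α : Type*} (β : α → M) : (L₀.sum L₁).Term α → Part M
  | .var x => Part.some (β x)
  | .func (Sum.inl f) ts => (partTuple fun i => eval β (ts i)).map (A.funMap f)
  | .func (Sum.inr f) ts => (partTuple fun i => eval β (ts i)).bind (A.extFun f)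

/-- All terms of the atom are defined. -/
def AtomDefined {α : Type*} (β : α → M) (a : Atom L₀ L₁ α) : Prop :=
  ∀ t ∈ a.terms, (A.eval β t).Dom

/-- All terms of the atom are defined and the atom is true. -/
def AtomTrue {α : Type*} (β : α → M) : Atom L₀ L₁ α → Prop
  | .eq t s => ∃ m, m ∈ A.eval β t ∧ m ∈ A.eval β s
  | .rel R ts => ∃ m, (∀ i, m i ∈ A.eval β (ts i)) ∧ A.RelMap R m

/-- All terms of the literal are defined and the literal is true. -/
def LiteralTrue {α : Type*} (β : α → M) : Literal L₀ L₁ α → Prop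
  | .pos a => A.AtomTrue β a
  | .neg a => A.AtomDefined β a ∧ ¬ A.AtomTrue β a

/-- `A` weakly satisfies `C`: under every valuation, some literal of `C` is undefined, or all are
defined and at least one is true. -/
def WeaklySatisfies (C : Clause L₀ L₁) : Prop :=
  ∀ β : ℕ → M, (∀ l ∈ C, A.AtomDefined β l.atom) → ∃ l ∈ C, A.LiteralTrue β l

/-- The set `T(A)` of ground terms `f(a₁, …, aₙ)`, with `f` an extension function and elements of
the universe as constants, whose value `f_A(a₁, …, aₙ)` is defined. -/
def definedApps : Set ((L₀.sum L₁).Term M) :=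
  {t | ∃ (n : ℕ) (f : L₁.Functions n) (a : Fin n → M), (A.extFun f a).Dom ∧
    t = Term.func (Sum.inr f) fun i => Term.var (a i)}

/-- The ground terms, with elements of the universe as constants, that are defined in `A`. -/
def definedTerms : Set ((L₀.sum L₁).Term M) :=
  {t | (A.eval id t).Dom}

/-- Membership in `PMod_{w,f}`: the `L₀`-reduct is a model of `T₀`, `A` is a weak partial model of
`K`, and `T(A)` is finite. -/
structure IsPMod (T₀ : L₀.Theory) (K : Set (Clause L₀ L₁)) : Prop where
  base : @Theory.Model L₀ M A.toStructure T₀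
  weak : ∀ C ∈ K, A.WeaklySatisfies C
  finite : A.definedApps.Finite

/-- `A` is a (total) model of `T₀ ∪ K`. -/
structure IsTotalModel (T₀ : L₀.Theory) (K : Set (Clause L₀ L₁)) : Prop where
  total : ∀ {n : ℕ} (f : L₁.Functions n) (a : Fin n → M), (A.extFun f a).Dom
  base : @Theory.Model L₀ M A.toStructure T₀
  clauses : ∀ C ∈ K, ∀ β : ℕ → M, ∃ l ∈ C, A.LiteralTrue β l

end PartialExpansion

/-- Weak embeddings of partial structures. -/
structure IsWeakEmbedding {M N : Type u} (A : PartialExpansion L₀ L₁ M)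
    (B : PartialExpansion L₀ L₁ N) (φ : M → N) : Prop where
  injective : Function.Injective φ
  map_rel : ∀ {n : ℕ} (R : L₀.Relations n) (a : Fin n → M), A.RelMap R a ↔ B.RelMap R (φ ∘ a)
  map_fun : ∀ {n : ℕ} (f : L₀.Functions n) (a : Fin n → M),
    φ (A.funMap f a) = B.funMap f (φ ∘ a)
  map_extFun : ∀ {n : ℕ} (f : L₁.Functions n) (a : Fin n → M) (m : M),
    m ∈ A.extFun f a → φ m ∈ B.extFun f (φ ∘ a)

/-! ### The two amalgamation properties -/

/-- A set of terms over a subset of `U`, seen as a set of terms over `U`. -/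
def liftTerms {U : Type u} {S : Set U} (T : Set ((L₀.sum L₁).Term S)) :
    Set ((L₀.sum L₁).Term U) :=
  Term.relabel (Subtype.val : S → U) '' T

/-- The partial `W`-amalgamation property of the extension of `T₀` by `K`. The universes of
`A`, `B`, `C` are subsets `SA`, `SB` and `SA ∩ SB` of a common set `U`. -/
def PartialAmalgamation (T₀ : L₀.Theory) (K : Set (Clause L₀ L₁)) (W : TermOperator L₀ L₁) :
    Prop :=
  ∀ (U : Type u) (SA SB : Set U) (A : PartialExpansion L₀ L₁ SA) (B : PartialExpansion L₀ L₁ SB)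
    (C : PartialExpansion L₀ L₁ ↥(SA ∩ SB)),
    A.IsPMod T₀ K → B.IsPMod T₀ K → C.IsPMod T₀ K →
    IsWeakEmbedding C A (Set.inclusion Set.inter_subset_left) →
    IsWeakEmbedding C B (Set.inclusion Set.inter_subset_right) →
    W U (liftTerms A.definedApps) (liftTerms B.definedApps) ⊆ liftTerms A.definedTerms →
    W U (liftTerms B.definedApps) (liftTerms A.definedApps) ⊆ liftTerms B.definedTerms →
    liftTerms A.definedApps ∩ liftTerms B.definedApps ⊆ liftTerms C.definedApps →
    ∃ (D : Type u) (N : PartialExpansion L₀ L₁ D) (hA : SA → D) (hB : SB → D),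
      N.IsTotalModel T₀ K ∧ IsWeakEmbedding A N hA ∧ IsWeakEmbedding B N hB ∧
      ∀ c : ↥(SA ∩ SB),
        hA (Set.inclusion Set.inter_subset_left c) = hB (Set.inclusion Set.inter_subset_right c)

/-- The partial `W`-amalgamation property for models with the same reduct to the base signature. -/
def PartialAmalgamationSameReduct (T₀ : L₀.Theory) (K : Set (Clause L₀ L₁))
    (W : TermOperator L₀ L₁) : Prop :=
  ∀ (M : Type u) (A B : PartialExpansion L₀ L₁ M),
    A.IsPMod T₀ K → B.IsPMod T₀ K →
    A.toStructure = B.toStructure →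
    (∀ {n : ℕ} (f : L₁.Functions n) (a : Fin n → M) (m m' : M),
      m ∈ A.extFun f a → m' ∈ B.extFun f a → m = m') →
    W M A.definedApps B.definedApps ⊆ A.definedTerms →
    W M B.definedApps A.definedApps ⊆ B.definedTerms →
    ∃ (D : Type u) (N : PartialExpansion L₀ L₁ D) (hA hB : M → D),
      N.IsTotalModel T₀ K ∧ IsWeakEmbedding A N hA ∧ IsWeakEmbedding B N hB ∧ hA = hB

end WAmalg

namespace WAmalg

/-! ### Strong amalgamation from general ground interpolation -/

section StrongAmalgamation

/-! For the first implication, two partial models on one universe share a largest common part: the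
universe itself, with only those extension values that are defined in both. Amalgamating over this
part produces maps that agree everywhere.

For the second, the base reducts are first amalgamated, and the partial functions are then carried
into the amalgam. Ground interpolation yields a strong amalgam
(`GeneralGroundInterpolation.exists_amalgam`), in which the two sides meet only in their
intersection. By compactness, failure would mean that finite parts of the two ground diagrams are
jointly inconsistent with the theory. An interpolant mentions only common constants, so its truth
passes from one structure to the other, a contradiction. An additional predicate, true exactly on
the private elements of the first side and false on the second, forces the amalgam to be strong.

Pushing both partial models into the amalgam (`PartialExpansion.pushforward`) gives them the same
reduct. Guardedness of the variables keeps the clauses weakly satisfied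
(`weaklySatisfies_pushforward`). Strongness makes the partial functions compatible, and it supplies
the separation condition under which `W` commutes with renaming, so that `W`-closedness survives. -/

/-- A constant for each element of `U`. -/
inductive MarkedFunctions (U : Type u) : ℕ → Type u
  | const (c : U) : MarkedFunctions U 0

/-- A single unary predicate symbol. -/
inductive MarkedRelations : ℕ → Type u
  | mark : MarkedRelations 1

/-- The signature of a constant for each element of `U` and one unary predicate symbol. -/
def markedLanguage (U : Type u) : FirstOrder.Language.{u, u} :=
  ⟨MarkedFunctions U, MarkedRelations⟩

variable {L : FirstOrder.Language.{u, u}} {U : Type u}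

/-- The structure on `S` in which constants denote themselves if possible and `d` otherwise, and
in which the predicate symbol denotes `P`. -/
@[reducible]
noncomputable def markedStructure {S : Set U} (d : S) (P : S → Prop) :
    (markedLanguage U).Structure S where
  funMap f _ := match f with
    | .const c => open Classical in if h : c ∈ S then ⟨c, h⟩ else d
  RelMap R a := match R, a with
    | .mark, a => P (a 0)

/-- The constant `c`, as a term. -/
def constTerm (L : FirstOrder.Language.{u, u}) (c : U) :
    (L.sum (markedLanguage U)).Term (Empty ⊕ Fin 0) :=
  .func (Sum.inr (MarkedFunctions.const c)) Fin.elim0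

/-- The constants occurring in a formula belong to `S`. -/
def ConstantsIn (S : Set U) (φ : (L.sum (markedLanguage U)).Sentence) : Prop :=
  ∀ c : U, (⟨0, Sum.inr (MarkedFunctions.const c)⟩ :
    Σ n, (L.sum (markedLanguage U)).Functions n) ∈ formulaFunctions φ → c ∈ S

/-- The ground sentences over constants from `S` that hold in the structure on `S` in which the
predicate symbol denotes `P`. -/
def markedDiagram (L : FirstOrder.Language.{u, u}) {S : Set U} [L.Structure S] (d : S)
    (P : S → Prop) : (L.sum (markedLanguage U)).Theory :=
  letI := markedStructure d P
  {φ | φ.IsQF ∧ ConstantsIn S φ ∧ S ⊨ φ}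

theorem constantsIn_inf {S : Set U} {φ ψ : (L.sum (markedLanguage U)).Sentence}
    (hφ : ConstantsIn S φ) (hψ : ConstantsIn S ψ) : ConstantsIn S (φ ⊓ ψ) := by
  intro c hc
  have hc' : _ ∈ (formulaFunctions φ ∪ (formulaFunctions ψ ∪ ∅)) ∪ ∅ := hc
  simp only [Set.union_empty] at hc'
  exact hc'.elim (hφ c) (hψ c)

/-- Interpolation concerns single sentences whereas compactness delivers finite sets; the
conjunction mediates between them and stays in the diagram. -/
theorem exists_conj_mem_markedDiagram {S : Set U} [L.Structure S] (d : S) (P : S → Prop)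
    {F : Set (L.sum (markedLanguage U)).Sentence} (hF : F.Finite)
    (hFS : F ⊆ markedDiagram L d P) :
    ∃ φ ∈ markedDiagram L d P, ∀ (M : Type u) [(L.sum (markedLanguage U)).Structure M],
      M ⊨ φ → ∀ ψ ∈ F, M ⊨ ψ := by
  let := markedStructure d P
  induction F, hF using Set.Finite.induction_on with
  | empty =>
    refine ⟨⊤, ⟨BoundedFormula.IsQF.top, ?_, ?_⟩, fun _ _ _ _ h => h.elim⟩
    · intro c hc
      have hc' : _ ∈ (∅ ∪ ∅ : Set (Σ n, (L.sum (markedLanguage U)).Functions n)) := hc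
      simp at hc'
    · simp [Sentence.Realize, Formula.Realize]
  | @insert ψ F _ _ ih =>
    obtain ⟨φ, hφ, h⟩ := ih fun x hx => hFS (Set.mem_insert_of_mem _ hx)
    obtain ⟨q, c, r⟩ := hFS (Set.mem_insert ψ F)
    refine ⟨ψ ⊓ φ, ⟨q.inf hφ.1, constantsIn_inf c hφ.2.1, ?_⟩, ?_⟩
    · have := hφ.2.2
      simp only [Sentence.Realize, Formula.Realize, BoundedFormula.realize_inf] at *
      exact ⟨r, this⟩
    · intro M _ hM χ hχ
      simp only [Sentence.Realize, Formula.Realize, BoundedFormula.realize_inf] at hM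
      rcases hχ with rfl | hχ
      · exact hM.1
      · exact h M hM.2 χ hχ

/-- Ground sentences over the common constants hold in one structure iff they hold in the other,
if the predicate agrees on the common part. -/
theorem realize_iff_of_common {SA SB SC : Set U} [L.Structure SA] [L.Structure SB] [L.Structure SC]
    (iA : SC ↪[L] SA) (iB : SC ↪[L] SB) (hiA : ∀ c, (iA c : U) = c) (hiB : ∀ c, (iB c : U) = c)
    (dA : SA) (dB : SB) (PA : SA → Prop) (PB : SB → Prop) (hP : ∀ c, PA (iA c) ↔ PB (iB c))
    {φ : (L.sum (markedLanguage U)).Sentence} (hφ : φ.IsQF) (hc : ConstantsIn SC φ) :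
    letI := markedStructure dA PA
    let := markedStructure dB PB
    SA ⊨ φ ↔ SB ⊨ φ := by
  let := markedStructure dA PA
  let := markedStructure dB PB
  -- The common part contains the common constants and is closed under the base functions, so such
  -- terms take the same value on both sides, and it lies in the common part.
  have term : ∀ t : (L.sum (markedLanguage U)).Term (Empty ⊕ Fin 0),
      (∀ c : U, (⟨0, Sum.inr (MarkedFunctions.const c)⟩ :
        Σ n, (L.sum (markedLanguage U)).Functions n) ∈ termFunctions t → c ∈ SC) →
      ∃ c : SC, t.realize (Sum.elim default default) = iA c ∧
        t.realize (Sum.elim default default) = iB c := by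
    intro t
    induction t with
    | var x => exact x.elim (fun x => x.elim) fun x => x.elim0
    | func f ts ih =>
      intro h
      have h' : ∀ i, ∃ c : SC, (ts i).realize (Sum.elim default default) = iA c ∧
          (ts i).realize (Sum.elim default default) = iB c := fun i =>
        ih i fun c hc => h c (Or.inr (Set.mem_iUnion.2 ⟨i, hc⟩))
      choose c hcA hcB using h'
      rcases f with f | f
      · refine ⟨Structure.funMap f c, ?_, ?_⟩
        · rw [iA.map_fun]
          exact congrArg (Structure.funMap f) (funext hcA)
        · rw [iB.map_fun]
          exact congrArg (Structure.funMap f) (funext hcB)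
      · cases f with
        | const u =>
          have hu : u ∈ SC := h u (Or.inl rfl)
          have hA : u ∈ SA := by simpa [hiA] using (iA ⟨u, hu⟩).2
          have hB : u ∈ SB := by simpa [hiB] using (iB ⟨u, hu⟩).2
          refine ⟨⟨u, hu⟩, Subtype.ext ?_, Subtype.ext ?_⟩
          · rw [hiA]
            exact congrArg Subtype.val (dif_pos hA)
          · rw [hiB]
            exact congrArg Subtype.val (dif_pos hB)
  change BoundedFormula.Realize φ default default ↔ BoundedFormula.Realize φ default default
  unfold ConstantsIn at hc
  induction hφ with
  | falsum => exact Iff.rfl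
  | of_isAtomic h =>
    cases h with
    | equal t s =>
      obtain ⟨c, hcA, hcB⟩ := term t fun c h => hc c (Or.inl h)
      obtain ⟨e, heA, heB⟩ := term s fun c h => hc c (Or.inr h)
      rw [BoundedFormula.realize_bdEqual, BoundedFormula.realize_bdEqual, hcA, hcB, heA, heB,
        iA.injective.eq_iff, iB.injective.eq_iff]
    | rel R ts =>
      have h' := fun i => term (ts i) fun c h => hc c (Set.mem_iUnion.2 ⟨i, h⟩)
      choose c hcA hcB using h'
      rw [BoundedFormula.realize_rel, BoundedFormula.realize_rel, funext hcA, funext hcB]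
      rcases R with R | R
      · exact (iA.map_rel R c).trans (iB.map_rel R c).symm
      · cases R with
        | mark => exact hP (c 0)
  | imp _ _ h₁ h₂ =>
    rw [BoundedFormula.realize_imp, BoundedFormula.realize_imp,
      h₁ fun c h => hc c (Or.inl h), h₂ fun c h => hc c (Or.inr h)]

/-- A model of the marked diagram of `S` contains a copy of `S`. -/
theorem embedding_of_markedDiagram {S : Set U} [L.Structure S] (d : S) (P : S → Prop) (M : Type u)
    [L.Structure M] [(L.sum (markedLanguage U)).Structure M]
    [(LHom.sumInl : L →ᴸ L.sum (markedLanguage U)).IsExpansionOn M]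
    (hM : ∀ φ ∈ markedDiagram L d P, M ⊨ φ) :
    (∃ g : S ↪[L] M, ∀ a : S, g a = (constTerm L (a : U)).realize default) ∧
    ∀ a : S, P a ↔ @Structure.RelMap (L.sum (markedLanguage U)) M _ 1
      (Sum.inr MarkedRelations.mark) fun _ => (constTerm L (a : U)).realize (default : Empty ⊕ Fin 0 → M) := by
  let := markedStructure d P
  -- The diagram contains the negation of each admissible sentence that fails in `S`, so truth is
  -- also reflected from `M`.
  have key : ∀ φ : (L.sum (markedLanguage U)).Sentence, φ.IsQF → ConstantsIn S φ →
      (S ⊨ φ ↔ M ⊨ φ) := by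
    intro φ h₁ h₂
    refine ⟨fun h => hM φ ⟨h₁, h₂, h⟩, fun h => by_contra fun hn => ?_⟩
    have : M ⊨ φ.not := hM _ ⟨h₁.not, fun c hc => h₂ c ?_, hn⟩
    · exact this h
    · have hc' : _ ∈ formulaFunctions φ ∪ ∅ := hc
      simpa using hc'
  have constS : ∀ (a : S) (v : Empty ⊕ Fin 0 → S), (constTerm L (a : U)).realize v = a :=
    fun a _ => Subtype.ext (congrArg Subtype.val (dif_pos a.2))
  have constIn : ∀ (a : S) (c : U), (⟨0, Sum.inr (MarkedFunctions.const c)⟩ :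
      Σ n, (L.sum (markedLanguage U)).Functions n) ∈ termFunctions (constTerm L (a : U)) →
      c ∈ S := by
    intro a c hc
    rcases hc with hc | hc
    · cases hc
      exact a.2
    · obtain ⟨i, -⟩ := Set.mem_iUnion.1 hc
      exact i.elim0
  have inj : ∀ a b : S, a = b ↔ (constTerm L (a : U)).realize (default : Empty ⊕ Fin 0 → M) =
      (constTerm L (b : U)).realize default := by
    intro a b
    have := key ((constTerm L (a : U)).bdEqual (constTerm L (b : U)))
      (.of_isAtomic (.equal _ _)) fun c hc => hc.elim (constIn a c) (constIn b c)
    simp only [Sentence.Realize, Formula.Realize, BoundedFormula.realize_bdEqual, constS] at this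
    -- There are no free variables, hence only one valuation.
    rw [this, Subsingleton.elim (Sum.elim _ _) (default : Empty ⊕ Fin 0 → M)]
  have rel : ∀ {n : ℕ} (R : (L.sum (markedLanguage U)).Relations n) (a : Fin n → S),
      Structure.RelMap R a ↔ Structure.RelMap R
        fun i => (constTerm L (a i : U)).realize (default : Empty ⊕ Fin 0 → M) := by
    intro n R a
    have := key (R.boundedFormula fun i => constTerm L (a i : U))
      (.of_isAtomic (.rel _ _)) fun c hc => by
        obtain ⟨i, hi⟩ := Set.mem_iUnion.1 hc
        exact constIn _ c hi
    simp only [Sentence.Realize, Formula.Realize, BoundedFormula.realize_rel, constS] at this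
    rw [this, Subsingleton.elim (Sum.elim _ _) (default : Empty ⊕ Fin 0 → M)]
  refine ⟨⟨⟨⟨fun a => (constTerm L (a : U)).realize default, fun a b h => (inj a b).2 h⟩,
    ?_, ?_⟩, fun _ => rfl⟩, fun a => rel (n := 1) (Sum.inr MarkedRelations.mark) fun _ => a⟩
  · intro n f a
    have := key (Term.bdEqual (constTerm L (Structure.funMap f a : S).1)
      (.func (Sum.inl f) fun i => constTerm L (a i : U)))
      (.of_isAtomic (.equal _ _)) fun c hc => by
        rcases hc with hc | hc | hc
        · exact constIn _ c hc
        · cases hc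
        · obtain ⟨i, hi⟩ := Set.mem_iUnion.1 hc
          exact constIn _ c hi
    simp only [Sentence.Realize, Formula.Realize, BoundedFormula.realize_bdEqual, constS] at this
    rw [Subsingleton.elim (Sum.elim _ _) (default : Empty ⊕ Fin 0 → M)] at this
    exact (this.1 (congrArg (Structure.funMap f) (funext fun i => (constS (a i) _).symm))).trans
      (LHom.funMap_sumInl ..)
  · intro n R a
    exact ((LHom.sumInl : L →ᴸ L.sum (markedLanguage U)).map_onRelation R _).symm.to_iff.trans
      (rel (Sum.inl R) a).symm

/-- General ground interpolation implies strong amalgamation. -/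
theorem GeneralGroundInterpolation.exists_amalgam {T : L.Theory}
    (hT : GeneralGroundInterpolation T) {SA SB : Set U} [L.Structure SA] [L.Structure SB]
    [L.Structure ↥(SA ∩ SB)] [SA ⊨ T] [SB ⊨ T] [hne : Nonempty ↥(SA ∩ SB)]
    (iA : ↥(SA ∩ SB) ↪[L] SA) (iB : ↥(SA ∩ SB) ↪[L] SB)
    (hiA : ∀ c, (iA c : U) = c) (hiB : ∀ c, (iB c : U) = c) :
    ∃ (M : Type u) (_ : L.Structure M) (gA : SA ↪[L] M) (gB : SB ↪[L] M),
      M ⊨ T ∧ ∀ a b, gA a = gB b ↔ (a : U) = b := by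
  obtain ⟨c₀⟩ := hne
  -- An inequation between private elements of the two sides involves constants of both, so it
  -- belongs to neither diagram. The predicate splits it into one assertion about each side. On the
  -- intersection it is false in both structures, so it may occur in the interpolant.
  let PA : SA → Prop := fun a => (a : U) ∉ SB
  let PB : SB → Prop := fun _ => False
  let Δ := markedDiagram L (iA c₀) PA
  let Γ := markedDiagram L (iB c₀) PB
  let T' : (L.sum (markedLanguage U)).Theory := LHom.sumInl.onTheory T
  have sat : (T' ∪ (Δ ∪ Γ)).IsSatisfiable := by
    rw [Theory.isSatisfiable_iff_isFinitelySatisfiable]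
    intro F hF
    by_contra hunsat
    obtain ⟨α, ⟨hα₁, hα₂, hα₃⟩, hα⟩ := exists_conj_mem_markedDiagram (iA c₀) PA
      (F.finite_toSet.inter_of_left Δ) Set.inter_subset_right
    obtain ⟨β, ⟨hβ₁, hβ₂, hβ₃⟩, hβ⟩ := exists_conj_mem_markedDiagram (iB c₀) PB
      (F.finite_toSet.inter_of_left Γ) Set.inter_subset_right
    obtain ⟨I, hI, hIf, -, hAI, hBI⟩ := hT (markedLanguage U) α β hα₁ hβ₁ <| by
      rw [Theory.models_sentence_iff]
      intro M
      simp only [Sentence.Realize, Formula.Realize, BoundedFormula.realize_imp,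
        BoundedFormula.realize_inf, BoundedFormula.realize_bot, imp_false]
      rintro ⟨h₁, h₂⟩
      refine hunsat (@Theory.Model.isSatisfiable _ _ M _ _ ⟨fun φ hφ => ?_⟩)
      rcases hF hφ with h | h | h
      · exact M.is_model.realize_of_mem _ h
      · exact hα M h₁ φ ⟨hφ, h⟩
      · exact hβ M h₂ φ ⟨hφ, h⟩
    let := markedStructure (iA c₀) PA
    let := markedStructure (iB c₀) PB
    have : Nonempty SA := ⟨iA c₀⟩
    have : Nonempty SB := ⟨iB c₀⟩
    have mA : SA ⊨ T' := (LHom.onTheory_model _ _).2 inferInstance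
    have mB : SB ⊨ T' := (LHom.onTheory_model _ _).2 inferInstance
    have hA : SA ⊨ I := (hAI.realize_sentence SA) hα₃
    -- A constant of `I` occurs in both `α` and `β`, hence lies in `SA ∩ SB`; this is what lets the
    -- truth of `I` cross over.
    have hB : SB ⊨ I := (realize_iff_of_common iA iB hiA hiB (iA c₀) (iB c₀) PA PB
      (fun c => by simp [PA, PB, hiA, c.2.2]) hI fun c hc =>
        ⟨hα₂ c (hIf _ _ hc).1, hβ₂ c (hIf _ _ hc).2⟩).1 hA
    have := hBI.realize_sentence SB
    simp only [Sentence.Realize, Formula.Realize, BoundedFormula.realize_imp,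
      BoundedFormula.realize_inf, BoundedFormula.realize_bot, imp_false] at this
    exact this ⟨hβ₃, hB⟩
  obtain ⟨M⟩ := sat
  let : L.Structure M := (LHom.sumInl : L →ᴸ L.sum (markedLanguage U)).reduct M
  have real : ∀ φ ∈ T' ∪ (Δ ∪ Γ), M ⊨ φ := fun φ hφ => M.is_model.realize_of_mem φ hφ
  obtain ⟨⟨gA, hgA⟩, hPA⟩ := embedding_of_markedDiagram (L := L) (iA c₀) PA M
    fun φ hφ => real φ (Or.inr (Or.inl hφ))
  obtain ⟨⟨gB, hgB⟩, hPB⟩ := embedding_of_markedDiagram (L := L) (iB c₀) PB M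
    fun φ hφ => real φ (Or.inr (Or.inr hφ))
  refine ⟨M, inferInstance, gA, gB, (LHom.onTheory_model LHom.sumInl T).1
    ⟨fun φ hφ => real φ (Or.inl hφ)⟩, fun a b => ⟨fun h => ?_, fun h => ?_⟩⟩
  -- A shared `a` is also named by a constant of the diagram of `SB`, so injectivity of `gB`
  -- applies. A private `a` carries the predicate, which no image of `gB` does.
  · by_cases ha : (a : U) ∈ SB
    · have : gB ⟨a, ha⟩ = gB b := by rw [← h, hgA, hgB]
      exact congrArg Subtype.val (gB.injective this)
    · rw [hgA, hgB] at h
      have := (hPA a).1 ha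
      rw [h] at this
      exact ((hPB b).2 this).elim
  · rw [hgA, hgB, h]

end StrongAmalgamation

/-! ### Partial evaluation and weak embeddings -/

section Partial

variable {L₀ L₁ : FirstOrder.Language.{u, u}} {M N D : Type u}

theorem mem_partTuple {n : ℕ} {p : Fin n → Part M} {a : Fin n → M} :
    a ∈ partTuple p ↔ ∀ i, a i ∈ p i := by
  constructor
  · rintro ⟨h, rfl⟩ i
    exact Part.get_mem (h i)
  · intro h
    exact ⟨fun i => (h i).1, funext fun i => (h i).2⟩

/-! ### Strict evaluation of terms, atoms and literals -/

namespace PartialExpansion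

variable (A : PartialExpansion L₀ L₁ M)

theorem mem_eval_inl {α : Type*} {β : α → M} {n : ℕ} {f : L₀.Functions n}
    {ts : Fin n → (L₀.sum L₁).Term α} {m : M} :
    m ∈ A.eval β (.func (Sum.inl f) ts) ↔
      ∃ a : Fin n → M, (∀ i, a i ∈ A.eval β (ts i)) ∧ A.funMap f a = m := by
  simp [eval, Part.mem_map_iff, mem_partTuple]

theorem mem_eval_inr {α : Type*} {β : α → M} {n : ℕ} {f : L₁.Functions n}
    {ts : Fin n → (L₀.sum L₁).Term α} {m : M} :
    m ∈ A.eval β (.func (Sum.inr f) ts) ↔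
      ∃ a : Fin n → M, (∀ i, a i ∈ A.eval β (ts i)) ∧ m ∈ A.extFun f a := by
  simp [eval, Part.mem_bind_iff, mem_partTuple]

theorem mem_eval_var {α : Type*} {β : α → M} {x : α} {m : M} :
    m ∈ A.eval β (.var x) ↔ m = β x := by
  simp [eval]

theorem eval_relabel {α γ : Type*} (h : α → γ) (β : γ → M) (t : (L₀.sum L₁).Term α) :
    A.eval β (t.relabel h) = A.eval (β ∘ h) t := by
  induction t with
  | var x => rfl
  | func f ts ih => rcases f with f | f <;> simp [Term.relabel, eval, ih]

theorem eval_congr {α : Type*} {β γ : α → M} {t : (L₀.sum L₁).Term α}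
    (h : ∀ x, Term.var x ∈ subterms t → β x = γ x) : A.eval β t = A.eval γ t := by
  induction t with
  | var x => simp [eval, h x rfl]
  | func f ts ih =>
    have := fun i => ih i fun x hx => h x (Or.inr (Set.mem_iUnion.2 ⟨i, hx⟩))
    rcases f with f | f <;> simp [eval, this]

theorem eval_dom_of_mem_subterms {α : Type*} {β : α → M} {t s : (L₀.sum L₁).Term α}
    (ht : (A.eval β t).Dom) (hs : s ∈ subterms t) : (A.eval β s).Dom := by
  induction t with
  | var x =>
    cases hs
    exact ht
  | func f ts ih =>
    rcases hs with hs | hs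
    · cases hs
      exact ht
    · obtain ⟨i, hi⟩ := Set.mem_iUnion.1 hs
      obtain ⟨m, hm⟩ := Part.dom_iff_mem.1 ht
      refine ih i ?_ hi
      rcases f with f | f
      · obtain ⟨a, ha, -⟩ := A.mem_eval_inl.1 hm
        exact (ha i).1
      · obtain ⟨a, ha, -⟩ := A.mem_eval_inr.1 hm
        exact (ha i).1

theorem atomTrue_congr {α : Type*} {β γ : α → M} {a : Atom L₀ L₁ α}
    (h : ∀ t ∈ a.terms, A.eval β t = A.eval γ t) : A.AtomTrue β a ↔ A.AtomTrue γ a := by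
  cases a with
  | eq t s => simp [AtomTrue, h t (by simp [Atom.terms]), h s (by simp [Atom.terms])]
  | rel R ts => simp [AtomTrue, fun i => h (ts i) (by simp [Atom.terms])]

theorem atomDefined_congr {α : Type*} {β γ : α → M} {a : Atom L₀ L₁ α}
    (h : ∀ t ∈ a.terms, A.eval β t = A.eval γ t) : A.AtomDefined β a ↔ A.AtomDefined γ a :=
  forall₂_congr fun t ht => by rw [h t ht]

theorem literalTrue_congr {α : Type*} {β γ : α → M} {l : Literal L₀ L₁ α}
    (h : ∀ t ∈ l.atom.terms, A.eval β t = A.eval γ t) :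
    A.LiteralTrue β l ↔ A.LiteralTrue γ l := by
  cases l with
  | pos a => exact A.atomTrue_congr h
  | neg a => exact and_congr (A.atomDefined_congr h) (not_congr (A.atomTrue_congr h))

end PartialExpansion

/-! ### Weak embeddings preserve defined values and reflect clauses -/

namespace IsWeakEmbedding

variable {A : PartialExpansion L₀ L₁ M} {B : PartialExpansion L₀ L₁ N} {E : PartialExpansion L₀ L₁ D}
  {φ : M → N} {ψ : N → D}

theorem comp (hψ : IsWeakEmbedding B E ψ) (hφ : IsWeakEmbedding A B φ) :
    IsWeakEmbedding A E (ψ ∘ φ) where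
  injective := hψ.injective.comp hφ.injective
  map_rel R a := (hφ.map_rel R a).trans (hψ.map_rel R _)
  map_fun f a := (congrArg ψ (hφ.map_fun f a)).trans (hψ.map_fun f _)
  map_extFun f a m h := hψ.map_extFun f _ _ (hφ.map_extFun f a m h)

theorem mem_eval (hφ : IsWeakEmbedding A B φ) {α : Type*} {β : α → M}
    {t : (L₀.sum L₁).Term α} {m : M} (h : m ∈ A.eval β t) : φ m ∈ B.eval (φ ∘ β) t := by
  induction t generalizing m with
  | var x => simpa [PartialExpansion.eval] using congrArg φ (A.mem_eval_var.1 h)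
  | func f ts ih =>
    rcases f with f | f
    · obtain ⟨a, ha, rfl⟩ := A.mem_eval_inl.1 h
      exact B.mem_eval_inl.2 ⟨φ ∘ a, fun i => ih i (ha i), (hφ.map_fun f a).symm⟩
    · obtain ⟨a, ha, hm⟩ := A.mem_eval_inr.1 h
      exact B.mem_eval_inr.2 ⟨φ ∘ a, fun i => ih i (ha i), hφ.map_extFun f a m hm⟩

theorem eval_dom (hφ : IsWeakEmbedding A B φ) {α : Type*} {β : α → M}
    {t : (L₀.sum L₁).Term α} (h : (A.eval β t).Dom) : (B.eval (φ ∘ β) t).Dom :=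
  (hφ.mem_eval (Part.get_mem h)).1

theorem relabel_mem_definedTerms (hφ : IsWeakEmbedding A B φ) {t : (L₀.sum L₁).Term M}
    (h : t ∈ A.definedTerms) : t.relabel φ ∈ B.definedTerms := by
  change (B.eval id (t.relabel φ)).Dom
  rw [B.eval_relabel]
  exact hφ.eval_dom (β := id) h

/-- Once every term has a value in `A`, its value in `B` is the image of that value, so injectivity
and the reflection of predicates give the converse. Without definedness the atom could be true in
`B` only. -/
theorem atomTrue_iff (hφ : IsWeakEmbedding A B φ) {α : Type*} {β : α → M} {a : Atom L₀ L₁ α}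
    (h : A.AtomDefined β a) : A.AtomTrue β a ↔ B.AtomTrue (φ ∘ β) a := by
  cases a with
  | eq t s =>
    obtain ⟨m, hm⟩ := Part.dom_iff_mem.1 (h t (by simp [Atom.terms]))
    obtain ⟨k, hk⟩ := Part.dom_iff_mem.1 (h s (by simp [Atom.terms]))
    constructor
    · rintro ⟨x, h₁, h₂⟩
      exact ⟨φ x, hφ.mem_eval h₁, hφ.mem_eval h₂⟩
    · rintro ⟨x, h₁, h₂⟩
      have := hφ.injective ((Part.mem_unique (hφ.mem_eval hm) h₁).trans
        (Part.mem_unique h₂ (hφ.mem_eval hk)))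
      exact ⟨m, hm, this ▸ hk⟩
  | rel R ts =>
    have := fun i => Part.dom_iff_mem.1 (h (ts i) (by simp [Atom.terms]))
    choose m hm using this
    constructor
    · rintro ⟨x, h₁, h₂⟩
      exact ⟨φ ∘ x, fun i => hφ.mem_eval (h₁ i), (hφ.map_rel R x).1 h₂⟩
    · rintro ⟨x, h₁, h₂⟩
      obtain rfl : x = φ ∘ m := funext fun i => Part.mem_unique (h₁ i) (hφ.mem_eval (hm i))
      exact ⟨m, hm, (hφ.map_rel R m).2 h₂⟩

theorem literalTrue_iff (hφ : IsWeakEmbedding A B φ) {α : Type*} {β : α → M}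
    {l : Literal L₀ L₁ α} (h : A.AtomDefined β l.atom) :
    A.LiteralTrue β l ↔ B.LiteralTrue (φ ∘ β) l := by
  cases l with
  | pos a => exact hφ.atomTrue_iff h
  | neg a =>
    exact and_congr (iff_of_true h fun t ht => hφ.eval_dom (h t ht)) (not_congr (hφ.atomTrue_iff h))

/-- Weak embeddings reflect the weak satisfaction of clauses. -/
theorem weaklySatisfies (hφ : IsWeakEmbedding A B φ) {C : Clause L₀ L₁}
    (h : B.WeaklySatisfies C) : A.WeaklySatisfies C := by
  intro β hβ
  obtain ⟨l, hl, ht⟩ := h (φ ∘ β) fun l hl t ht => hφ.eval_dom (hβ l hl t ht)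
  exact ⟨l, hl, (hφ.literalTrue_iff (hβ l hl)).2 ht⟩

end IsWeakEmbedding

/-! ### Transport along maps of universes -/

/-- Together with the compatibility of `W` with renaming, this carries `W`-closedness into the
amalgam. -/
theorem liftTerms_subset_of_relabel {U : Type u} {S : Set U} {g : U → M}
    {B : PartialExpansion L₀ L₁ S} {A : PartialExpansion L₀ L₁ M}
    (h : IsWeakEmbedding B A fun s => g s) :
    Term.relabel g '' liftTerms B.definedTerms ⊆ A.definedTerms := by
  rintro _ ⟨_, ⟨t, ht, rfl⟩, rfl⟩
  rw [Term.relabel_relabel]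
  exact h.relabel_mem_definedTerms ht

namespace PartialExpansion

/-- The partial expansion of `A` to an overstructure `N` of its base reduct, with no further values
of the extension functions. -/
noncomputable def pushforward [L₀.Structure N] (A : PartialExpansion L₀ L₁ M) (g : M → N) :
    PartialExpansion L₀ L₁ N where
  nonempty := A.nonempty.map g
  -- The choice of preimage is immaterial for injective `g`, the only case in which the value is
  -- examined.
  extFun f b := ⟨∃ a, g ∘ a = b ∧ (A.extFun f a).Dom, fun h =>
    g ((A.extFun f h.choose).get h.choose_spec.2)⟩
  const_dom c _ := ⟨Fin.elim0, Subsingleton.elim _ _, A.const_dom c _⟩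

section pushforward

variable [L₀.Structure N] {A : PartialExpansion L₀ L₁ M} {g : M → N}

theorem mem_pushforward_extFun (hg : Function.Injective g) {n : ℕ} {f : L₁.Functions n}
    {b : Fin n → N} {x : N} :
    x ∈ (A.pushforward g).extFun f b ↔ ∃ a, g ∘ a = b ∧ ∃ m ∈ A.extFun f a, g m = x := by
  constructor
  · rintro ⟨h, rfl⟩
    exact ⟨h.choose, h.choose_spec.1, _, Part.get_mem _, rfl⟩
  · rintro ⟨a, rfl, m, hm, rfl⟩
    have h : ∃ a', g ∘ a' = g ∘ a ∧ (A.extFun f a').Dom := ⟨a, rfl, hm.1⟩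
    refine ⟨h, congrArg g (Part.get_eq_of_mem ?_ h.choose_spec.2)⟩
    rwa [hg.comp_left h.choose_spec.1]

theorem isWeakEmbedding_pushforward
    (g : @FirstOrder.Language.Embedding L₀ M N A.toStructure _) :
    IsWeakEmbedding A (A.pushforward g) g where
  injective := @Language.Embedding.injective _ _ _ A.toStructure _ g
  map_rel R a := (@Language.Embedding.map_rel _ _ _ A.toStructure _ g _ R a).symm
  map_fun f a := @Language.Embedding.map_fun _ _ _ A.toStructure _ g _ f a
  map_extFun _ a m hm := (mem_pushforward_extFun
    (@Language.Embedding.injective _ _ _ A.toStructure _ g)).2 ⟨a, rfl, m, hm, rfl⟩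

theorem definedApps_pushforward : (A.pushforward g).definedApps =
    Term.relabel g '' A.definedApps := by
  ext t
  constructor
  · rintro ⟨n, f, _, ⟨a, rfl, h⟩, rfl⟩
    exact ⟨_, ⟨n, f, a, h, rfl⟩, rfl⟩
  · rintro ⟨_, ⟨n, f, a, h, rfl⟩, rfl⟩
    exact ⟨n, f, g ∘ a, ⟨a, rfl, h⟩, rfl⟩

/-- The image of `g` is closed under the base functions and contains all values of the extension
functions, so evaluation that starts in the image never leaves it and can be pulled back. -/
theorem eval_dom_of_pushforward
    (g : @FirstOrder.Language.Embedding L₀ M N A.toStructure _) {α : Type*} {β : α → M}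
    {t : (L₀.sum L₁).Term α} {x : N} (h : x ∈ (A.pushforward g).eval (g ∘ β) t) :
    ∃ m ∈ A.eval β t, g m = x := by
  have hg := isWeakEmbedding_pushforward g
  induction t generalizing x with
  | var y => exact ⟨β y, A.mem_eval_var.2 rfl, ((A.pushforward g).mem_eval_var.1 h).symm⟩
  | func f ts ih =>
    rcases f with f | f
    · obtain ⟨a, ha, rfl⟩ := (A.pushforward g).mem_eval_inl.1 h
      choose m hm hmx using fun i => ih i (ha i)
      obtain rfl : g ∘ m = a := funext hmx
      exact ⟨_, A.mem_eval_inl.2 ⟨m, hm, rfl⟩, hg.map_fun f m⟩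
    · obtain ⟨a, ha, hx⟩ := (A.pushforward g).mem_eval_inr.1 h
      choose m hm hmx using fun i => ih i (ha i)
      obtain rfl : g ∘ m = a := funext hmx
      obtain ⟨b, hb, k, hk, rfl⟩ := (mem_pushforward_extFun hg.injective).1 hx
      obtain rfl := hg.injective.comp_left hb
      exact ⟨k, A.mem_eval_inr.2 ⟨b, hm, hk⟩, rfl⟩

/-- If all variables are guarded by extension functions, then the weak satisfaction of clauses is
preserved by pushforwards. -/
theorem weaklySatisfies_pushforward {K : Set (Clause L₀ L₁)} (hK : VariablesGuarded K)
    (g : @FirstOrder.Language.Embedding L₀ M N A.toStructure _) {C : Clause L₀ L₁} (hC : C ∈ K)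
    (h : A.WeaklySatisfies C) : (A.pushforward g).WeaklySatisfies C := by
  classical
  have hg := isWeakEmbedding_pushforward g
  intro β hβ
  have hdef : ∀ t ∈ Clause.st C, ((A.pushforward g).eval β t).Dom := by
    intro t ht
    simp only [Clause.st, WAmalg.st, Set.mem_iUnion] at ht
    obtain ⟨l, hl, s, hs, hts⟩ := ht
    exact eval_dom_of_mem_subterms _ (hβ l hl s hs) hts
  -- In the pushforward, a defined application of an extension function has all its arguments in the
  -- image of `g`. Guardedness places every variable of the clause among such arguments.
  have hex : ∀ x : ℕ, Term.var x ∈ Clause.st C → ∃ m, g m = β x := by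
    intro x hx
    obtain ⟨n, f, ts, i, hf, hi⟩ := hK C hC x hx
    obtain ⟨y, hy⟩ := Part.dom_iff_mem.1 (hdef _ hf)
    obtain ⟨a, ha, hy⟩ := (A.pushforward g).mem_eval_inr.1 hy
    obtain ⟨b, rfl, -⟩ := (mem_pushforward_extFun hg.injective).1 hy
    have := ha i
    rw [hi] at this
    exact ⟨b i, (mem_eval_var _).1 this⟩
  obtain ⟨m₀⟩ := A.nonempty
  -- Variables outside the clause may take values outside the image; they get the dummy value `m₀`,
  -- which no term of the clause sees.
  let γ : ℕ → M := fun x => if hx : Term.var x ∈ Clause.st C then (hex x hx).choose else m₀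
  have hγ : ∀ x, Term.var x ∈ Clause.st C → β x = g (γ x) := by
    intro x hx
    simp only [γ, dif_pos hx]
    exact (hex x hx).choose_spec.symm
  have heval : ∀ l ∈ C, ∀ t ∈ l.atom.terms,
      (A.pushforward g).eval β t = (A.pushforward g).eval (g ∘ γ) t := by
    intro l hl t ht
    refine eval_congr _ fun x hx => hγ x ?_
    simp only [Clause.st, WAmalg.st, Set.mem_iUnion]
    exact ⟨l, hl, t, ht, hx⟩
  have hdefA : ∀ l ∈ C, A.AtomDefined γ l.atom := by
    intro l hl t ht
    have hd := hβ l hl t ht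
    rw [heval l hl t ht] at hd
    obtain ⟨m, hm, -⟩ := eval_dom_of_pushforward g (Part.get_mem hd)
    exact hm.1
  obtain ⟨l, hl, ht⟩ := h γ hdefA
  exact ⟨l, hl, (literalTrue_congr _ (heval l hl)).2
    ((hg.literalTrue_iff (hdefA l hl)).1 ht)⟩

theorem isPMod_pushforward {T₀ : L₀.Theory} [N ⊨ T₀] {K : Set (Clause L₀ L₁)}
    (hK : VariablesGuarded K) (g : @FirstOrder.Language.Embedding L₀ M N A.toStructure _)
    (hA : A.IsPMod T₀ K) : (A.pushforward g).IsPMod T₀ K where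
  base := ‹N ⊨ T₀›
  weak C hC := weaklySatisfies_pushforward hK g hC (hA.weak C hC)
  finite := by
    rw [definedApps_pushforward]
    exact hA.finite.image _

end pushforward

/-- Transport of a partial expansion along a bijection. -/
def transport (A : PartialExpansion L₀ L₁ M) (e : N ≃ M) : PartialExpansion L₀ L₁ N where
  funMap f a := e.symm (A.funMap f (e ∘ a))
  RelMap R a := A.RelMap R (e ∘ a)
  nonempty := A.nonempty.map e.symm
  extFun f a := (A.extFun f (e ∘ a)).map e.symm
  const_dom c _ := A.const_dom c _

section transport

variable (A : PartialExpansion L₀ L₁ M) (e : N ≃ M)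

theorem isWeakEmbedding_transport : IsWeakEmbedding (A.transport e) A e where
  injective := e.injective
  map_rel _ _ := Iff.rfl
  map_fun _ _ := e.apply_symm_apply _
  map_extFun f a m hm := by
    obtain ⟨k, hk, rfl⟩ := (Part.mem_map_iff _).1 hm
    simpa using hk

theorem isWeakEmbedding_transport_symm : IsWeakEmbedding A (A.transport e) e.symm where
  injective := e.symm.injective
  map_rel R a := by
    change A.RelMap R a ↔ A.RelMap R (e ∘ e.symm ∘ a)
    simp [← Function.comp_assoc]
  map_fun f a := by
    change e.symm (A.funMap f a) = e.symm (A.funMap f (e ∘ e.symm ∘ a))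
    simp [← Function.comp_assoc]
  map_extFun f a m hm := (Part.mem_map_iff _).2 ⟨m, by simpa [← Function.comp_assoc] using hm, rfl⟩

theorem definedApps_transport :
    (A.transport e).definedApps = Term.relabel e.symm '' A.definedApps := by
  ext t
  constructor
  · rintro ⟨n, f, a, h, rfl⟩
    exact ⟨_, ⟨n, f, e ∘ a, h, rfl⟩, by simp [Term.relabel]⟩
  · rintro ⟨_, ⟨n, f, a, h, rfl⟩, rfl⟩
    refine ⟨n, f, e.symm ∘ a, ?_, rfl⟩
    change (A.extFun f (e ∘ e.symm ∘ a)).Dom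
    simpa [← Function.comp_assoc] using h

theorem isPMod_transport {T₀ : L₀.Theory} {K : Set (Clause L₀ L₁)} (hA : A.IsPMod T₀ K) :
    (A.transport e).IsPMod T₀ K where
  base := by
    let := A.toStructure
    let := (A.transport e).toStructure
    let e' : M ≃[L₀] N := ⟨e.symm, (isWeakEmbedding_transport_symm A e).map_fun,
      fun R a => ((isWeakEmbedding_transport_symm A e).map_rel R a).symm⟩
    have : M ⊨ T₀ := hA.base
    exact StrongHomClass.theory_model (L := L₀) (F := M ≃[L₀] N) e'
  weak C hC := (isWeakEmbedding_transport A e).weaklySatisfies (hA.weak C hC)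
  finite := by
    rw [definedApps_transport]
    exact hA.finite.image _

end transport

/-- `PartialAmalgamation` takes subsets of a common set as universes. Presenting `M` as a full
subset of itself must not alter the terms to which `W` is applied. -/
theorem liftTerms_definedApps_transport (A : PartialExpansion L₀ L₁ M) {S : Set M}
    (hS : ∀ x, x ∈ S) :
    liftTerms (A.transport (Equiv.subtypeUnivEquiv hS)).definedApps = A.definedApps := by
  rw [definedApps_transport, liftTerms, Set.image_image]
  simp only [Term.relabel_relabel]
  have : (Subtype.val : S → M) ∘ (Equiv.subtypeUnivEquiv hS).symm = id := rfl
  simp [this]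

theorem subset_liftTerms_definedTerms_transport (A : PartialExpansion L₀ L₁ M) {S : Set M}
    (hS : ∀ x, x ∈ S) :
    A.definedTerms ⊆ liftTerms (A.transport (Equiv.subtypeUnivEquiv hS)).definedTerms := by
  intro t ht
  refine ⟨_, (isWeakEmbedding_transport_symm A _).relabel_mem_definedTerms ht, ?_⟩
  rw [Term.relabel_relabel]
  have : (Subtype.val : S → M) ∘ (Equiv.subtypeUnivEquiv hS).symm = id := rfl
  simp [this]

/-- The restriction of `A` to those values of the extension functions that are defined in `B`. -/
def restrictTo (A B : PartialExpansion L₀ L₁ M) : PartialExpansion L₀ L₁ M where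
  toStructure := A.toStructure
  nonempty := A.nonempty
  extFun f a := ⟨(A.extFun f a).Dom ∧ (B.extFun f a).Dom, fun h => (A.extFun f a).get h.1⟩
  const_dom c a := ⟨A.const_dom c a, B.const_dom c a⟩

section restrictTo

variable {A B : PartialExpansion L₀ L₁ M}

theorem isWeakEmbedding_restrictTo_left : IsWeakEmbedding (A.restrictTo B) A id where
  injective := Function.injective_id
  map_rel _ _ := Iff.rfl
  map_fun _ _ := rfl
  map_extFun _ _ _ := fun ⟨h, hm⟩ => ⟨h.1, hm⟩

theorem isWeakEmbedding_restrictTo_right (hAB : A.toStructure = B.toStructure)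
    (h : ∀ {n : ℕ} (f : L₁.Functions n) (a : Fin n → M) (m m' : M),
      m ∈ A.extFun f a → m' ∈ B.extFun f a → m = m') :
    IsWeakEmbedding (A.restrictTo B) B id where
  injective := Function.injective_id
  map_rel R a := by
    change A.RelMap R a ↔ B.RelMap R a
    rw [hAB]
  map_fun f a := by
    change A.funMap f a = B.funMap f a
    rw [hAB]
  map_extFun f a m := by
    rintro ⟨hd, rfl⟩
    have := h f a _ _ (Part.get_mem hd.1) (Part.get_mem hd.2)
    exact ⟨hd.2, this.symm⟩

/-- This makes the restriction suitable as the common part: the condition `T(A) ∩ T(B) ⊆ T(C)` holds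
with equality. -/
theorem definedApps_restrictTo :
    (A.restrictTo B).definedApps = A.definedApps ∩ B.definedApps := by
  ext t
  constructor
  · rintro ⟨n, f, a, h, rfl⟩
    exact ⟨⟨n, f, a, h.1, rfl⟩, ⟨n, f, a, h.2, rfl⟩⟩
  · rintro ⟨⟨n, f, a, h, rfl⟩, ⟨n', f', a', h', he⟩⟩
    obtain ⟨rfl, hf, ha⟩ := Term.func.inj he
    obtain rfl := Sum.inr_injective (eq_of_heq hf)
    obtain rfl : a = a' := funext fun i => Term.var.inj (congrFun (eq_of_heq ha) i)
    exact ⟨n, f, a, ⟨h, h'⟩, rfl⟩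

end restrictTo

end PartialExpansion

/-! ### Comparison of the two amalgamation properties -/

theorem PartialAmalgamation.sameReduct {T₀ : L₀.Theory} {K : Set (Clause L₀ L₁)}
    {W : TermOperator L₀ L₁} (h : PartialAmalgamation T₀ K W) :
    PartialAmalgamationSameReduct T₀ K W := by
  intro M A B hA hB hAB hcomp hWA hWB
  have hU : ∀ x : M, x ∈ Set.univ := Set.mem_univ
  -- The common part lives on `univ ∩ univ`, a different type from `univ`, hence a second
  -- equivalence `e'`.
  have hI : ∀ x : M, x ∈ Set.univ ∩ Set.univ := fun x => ⟨hU x, hU x⟩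
  let e := Equiv.subtypeUnivEquiv hU
  let e' := Equiv.subtypeUnivEquiv hI
  have hC : (A.restrictTo B).IsPMod T₀ K :=
    ⟨hA.base, fun C hC =>
      PartialExpansion.isWeakEmbedding_restrictTo_left.weaklySatisfies (hA.weak C hC),
      (hA.finite.subset (by
        rw [PartialExpansion.definedApps_restrictTo]; exact Set.inter_subset_left))⟩
  obtain ⟨D, N, hA', hB', hN, hAN, hBN, hagree⟩ := h M Set.univ Set.univ (A.transport e)
    (B.transport e) ((A.restrictTo B).transport e') (A.isPMod_transport e hA)
    (B.isPMod_transport e hB) (PartialExpansion.isPMod_transport _ e' hC)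
    ((A.isWeakEmbedding_transport_symm e).comp
      (PartialExpansion.isWeakEmbedding_restrictTo_left.comp
        (PartialExpansion.isWeakEmbedding_transport _ e')))
    ((B.isWeakEmbedding_transport_symm e).comp
      ((PartialExpansion.isWeakEmbedding_restrictTo_right hAB hcomp).comp
        (PartialExpansion.isWeakEmbedding_transport _ e')))
    (by
      rw [A.liftTerms_definedApps_transport, B.liftTerms_definedApps_transport]
      exact hWA.trans (A.subset_liftTerms_definedTerms_transport hU))
    (by
      rw [A.liftTerms_definedApps_transport, B.liftTerms_definedApps_transport]
      exact hWB.trans (B.subset_liftTerms_definedTerms_transport hU))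
    (by
      rw [A.liftTerms_definedApps_transport, B.liftTerms_definedApps_transport,
        PartialExpansion.liftTerms_definedApps_transport,
        PartialExpansion.definedApps_restrictTo])
  exact ⟨D, N, hA' ∘ e.symm, hB' ∘ e.symm, hN, hAN.comp (A.isWeakEmbedding_transport_symm e),
    hBN.comp (B.isWeakEmbedding_transport_symm e), funext fun m => hagree (e'.symm m)⟩

/-- Locates the constants on either side, as needed to check the separation hypothesis in the
compatibility of `W`. -/
theorem atomsOf_liftTerms_subset {U : Type u} {S : Set U} (T : Set ((L₀.sum L₁).Term S)) :
    atomsOf (liftTerms T) ⊆ S := by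
  have key : ∀ (t : (L₀.sum L₁).Term S) (x : U),
      Term.var x ∈ subterms (t.relabel (Subtype.val : S → U)) → x ∈ S := by
    intro t x
    induction t with
    | var y =>
      intro h
      cases h
      exact y.2
    | func f ts ih =>
      rintro (h | h)
      · cases h
      · obtain ⟨i, hi⟩ := Set.mem_iUnion.1 h
        exact ih i hi
  intro x hx
  simp only [atomsOf, st, Set.mem_ofPred_eq, Set.mem_iUnion] at hx
  obtain ⟨_, ⟨t, -, rfl⟩, hx⟩ := hx
  exact key t x hx

theorem PartialAmalgamationSameReduct.partialAmalgamation {T₀ : L₀.Theory}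
    {K : Set (Clause L₀ L₁)} {W : TermOperator L₀ L₁} (hW : IsAmalgamationClosure K W)
    (hT : GeneralGroundInterpolation T₀) (hK : VariablesGuarded K)
    (h : PartialAmalgamationSameReduct T₀ K W) : PartialAmalgamation T₀ K W := by
  classical
  intro U SA SB A B C hA hB hC hCA hCB hWA hWB hAB
  let := A.toStructure
  let := B.toStructure
  let := C.toStructure
  have : SA ⊨ T₀ := hA.base
  have : SB ⊨ T₀ := hB.base
  have := C.nonempty
  obtain ⟨M, _, gA, gB, hM, hg⟩ := hT.exists_amalgam
    (⟨⟨_, hCA.injective⟩, hCA.map_fun, fun R a => (hCA.map_rel R a).symm⟩ : ↥(SA ∩ SB) ↪[L₀] SA)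
    (⟨⟨_, hCB.injective⟩, hCB.map_fun, fun R a => (hCB.map_rel R a).symm⟩ : ↥(SA ∩ SB) ↪[L₀] SB)
    (fun _ => rfl) (fun _ => rfl)
  have hgA := PartialExpansion.isWeakEmbedding_pushforward (A := A) gA
  have hgB := PartialExpansion.isWeakEmbedding_pushforward (A := B) gB
  -- Compatibility of `W` needs one map on all of `U`. The embeddings agree on the overlap, so they
  -- glue; the value outside `SA ∪ SB` is arbitrary.
  let g : U → M := fun u =>
    if ha : u ∈ SA then gA ⟨u, ha⟩ else if hb : u ∈ SB then gB ⟨u, hb⟩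
    else gA (Classical.choice A.nonempty)
  have hgA' : ∀ a : SA, g a = gA a := fun a => dif_pos a.2
  have hgB' : ∀ b : SB, g b = gB b := by
    intro b
    by_cases ha : (b : U) ∈ SA
    · exact (dif_pos ha).trans ((hg ⟨b, ha⟩ b).2 rfl)
    · exact (dif_neg ha).trans (dif_pos b.2)
  have appsA : Term.relabel g '' liftTerms A.definedApps = (A.pushforward gA).definedApps := by
    rw [PartialExpansion.definedApps_pushforward, liftTerms, Set.image_image]
    simp only [Term.relabel_relabel]
    rw [show g ∘ Subtype.val = gA from funext hgA']
  have appsB : Term.relabel g '' liftTerms B.definedApps = (B.pushforward gB).definedApps := by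
    rw [PartialExpansion.definedApps_pushforward, liftTerms, Set.image_image]
    simp only [Term.relabel_relabel]
    rw [show g ∘ Subtype.val = gB from funext hgB']
  have sep : ∀ a ∈ SA, ∀ b ∈ SB, g a = g b → a = b := fun a ha b hb he =>
    (hg ⟨a, ha⟩ ⟨b, hb⟩).1 (by rwa [← hgA', ← hgB'])
  have atA := atomsOf_liftTerms_subset A.definedApps
  have atB := atomsOf_liftTerms_subset B.definedApps
  have finA : (liftTerms A.definedApps).Finite := hA.finite.image _
  have finB : (liftTerms B.definedApps).Finite := hB.finite.image _
  obtain ⟨D, N, f, _, hN, hfA, hfB, rfl⟩ := h M (A.pushforward gA) (B.pushforward gB)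
    (PartialExpansion.isPMod_pushforward hK gA hA) (PartialExpansion.isPMod_pushforward hK gB hB)
    rfl
    (by
      -- By strongness, equal argument tuples in `M` come from the same tuple in `U`. The
      -- application thus lies in `T(A) ∩ T(B)`, so it is defined in `C`, and both values are images
      -- of the value there.
      intro n f b m m' hm hm'
      obtain ⟨a, rfl, k, hk, rfl⟩ := (PartialExpansion.mem_pushforward_extFun gA.injective).1 hm
      obtain ⟨b, hab, k', hk', rfl⟩ := (PartialExpansion.mem_pushforward_extFun gB.injective).1 hm'
      have hval : ∀ i, (a i : U) = b i := fun i => (hg _ _).1 (congrFun hab i).symm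
      obtain ⟨_, ⟨n', f', c, hc, rfl⟩, he⟩ := hAB (a := Term.func (Sum.inr f) fun i => .var (a i : U))
        ⟨⟨_, ⟨n, f, a, hk.1, rfl⟩, rfl⟩, ⟨_, ⟨n, f, b, hk'.1, rfl⟩, by simp [Term.relabel, hval]⟩⟩
      obtain ⟨rfl, hf, ha⟩ := Term.func.inj he
      obtain rfl := Sum.inr_injective (eq_of_heq hf)
      have hca : ∀ i, (c i : U) = a i := fun i => Term.var.inj (congrFun (eq_of_heq ha) i)
      obtain ⟨x, hx⟩ := Part.dom_iff_mem.1 hc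
      have h₁ := hCA.map_extFun _ _ _ hx
      have h₂ := hCB.map_extFun _ _ _ hx
      rw [show Set.inclusion Set.inter_subset_left ∘ c = a from
        funext fun i => Subtype.ext (hca i)] at h₁
      rw [show Set.inclusion Set.inter_subset_right ∘ c = b from
        funext fun i => Subtype.ext ((hca i).trans (hval i))] at h₂
      obtain rfl := Part.mem_unique h₁ hk
      obtain rfl := Part.mem_unique h₂ hk'
      exact (hg _ _).2 rfl)
    (by
      -- If `g` identified a constant private to one set of terms with one private to the other,
      -- `sep` would make them equal, hence shared.
      rw [← appsA, ← appsB, hW.compat U M g _ _ finA finB fun a ha b hb he =>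
        ha.2 (sep a (atA ha.1) b (atB hb.1) he ▸ hb.1)]
      exact (Set.image_mono hWA).trans
        (liftTerms_subset_of_relabel (by simpa only [hgA'] using hgA)))
    (by
      rw [← appsA, ← appsB, hW.compat U M g _ _ finB finA fun b hb a ha he =>
        ha.2 (sep a (atA ha.1) b (atB hb.1) he.symm ▸ hb.1)]
      exact (Set.image_mono hWB).trans
        (liftTerms_subset_of_relabel (by simpa only [hgB'] using hgB)))
  exact ⟨D, N, f ∘ gA, f ∘ gB, hN, hfA.comp hgA, hfB.comp hgB, fun c =>
    congrArg f ((hg _ _).2 rfl)⟩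

end Partial

end WAmalg

theorem mainTheorem7 {L₀ L₁ : FirstOrder.Language.{u, u}} [L₁.IsAlgebraic]
    (T₀ : L₀.Theory) (K : Set (WAmalg.Clause L₀ L₁)) (W : WAmalg.TermOperator L₀ L₁)
    (hW : WAmalg.IsAmalgamationClosure K W) :
    (WAmalg.PartialAmalgamation T₀ K W → WAmalg.PartialAmalgamationSameReduct T₀ K W) ∧
    (WAmalg.GeneralGroundInterpolation T₀ → WAmalg.VariablesGuarded K →
      WAmalg.PartialAmalgamationSameReduct T₀ K W → WAmalg.PartialAmalgamation T₀ K W) := by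
  exact ⟨fun h => h.sameReduct, fun hT hK h => h.partialAmalgamation hW hT hK⟩
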